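/- Let $P_-$ be the square with vertices $(0,0),(4,0),(4,4),(0,4)$ and $P_+$ the rhombus with vertices $(6,5),(8,1),(12,-1),(10,3)$ (closed polygonal curves, vertices in cyclic order), with vertex sets $V_\pm$. The symplectic billiard map $\phi$ of the pair is defined on the set $\mathcal P_{\max}$ of all pairs $(x,y)\in (P_-\times P_+)\sqcup(P_+\times P_-)$, say $x\in P_\pm$ and $y\in P_\mp$, such that $y\notin V_\mp$ and there is exactly one point $z\in P_\pm$, $z\ne x$, on the line through $x$ parallel to the edge of $P_\mp$ containing $y$ for which the open segment $xz$ lies in the interior of $P_\pm$; then $\phi(x,y):=(y,z)$. Put $N_0:=(P_-\times V_+)\sqcup(P_+\times V_-)$, $N_{i+1}:=\phi^{-1}(N_i)$ for $i\ge 0$, $\sigma(x,y):=(y,x)$ and $N:=\bigcup_i N_i\cup\sigma\big(\bigcup_i N_i\big)$. The phase space is $\mathcal P:=\mathcal P_{\max}\setminus N$, and the set of critical points is $C:=\bigcup_{i\ge 0}\pi_2(N_{2i})\subset P_-\sqcup P_+$, where $\pi_2$ is the projection of a pair to its second component. Then: 1. every orbit of $\phi$ in $\mathcal P$ is periodic,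 but there is no uniform upper bound on the periods (that is, $(P_-,P_+)\in FP\setminus BP$); moreover, for every neighbourhood $U$ of the corner $(12,-1)$ of the rhombus there is a periodic orbit in $\mathcal P$ whose trajectory has a point of $P_+$ in $U$; 2. $C$ is infinite, and every limit point of $C$ in $P_-\sqcup P_+$ is a vertex of $P_-$ or of $P_+$. -/

import Mathlib

open Set Filter Topology

namespace SymplecticBilliard

/-- Points of the plane; only its topology, its bornology and its vector space structure are used. -/
abbrev Plane : Type := ℝ × ℝ

/-- An embedded polygon, given by its cyclically indexed vertices; three consecutive vertices are
not collinear. -/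
structure Polygon where
  n : ℕ
  three_le : 3 ≤ n
  vertex : ZMod n → Plane
  vertex_injective : Function.Injective vertex
  edges_disjoint : ∀ i j : ZMod n, i ≠ j →
    Disjoint (openSegment ℝ (vertex i) (vertex (i + 1))) (openSegment ℝ (vertex j) (vertex (j + 1)))
  vertex_notMem_edge : ∀ i j : ZMod n, vertex i ∉ openSegment ℝ (vertex j) (vertex (j + 1))
  not_collinear : ∀ i : ZMod n, ¬ Collinear ℝ {vertex i, vertex (i + 1), vertex (i + 2)}

namespace Polygon

/-- The polygon as a closed curve in the plane. -/
def curve (P : Polygon) : Set Plane := ⋃ i, segment ℝ (P.vertex i) (P.vertex (i + 1))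

/-- The set of vertices. -/
def vertices (P : Polygon) : Set Plane := range P.vertex

/-- The `i`-th open edge. -/
def edge (P : Polygon) (i : ZMod P.n) : Set Plane := openSegment ℝ (P.vertex i) (P.vertex (i + 1))

/-- The interior: the points off the curve that lie in a bounded connected component of the
complement of the curve. -/
def interior (P : Polygon) : Set Plane :=
  {x | x ∈ P.curveᶜ ∧ Bornology.IsBounded (connectedComponentIn P.curveᶜ x)}

/-- The tangent line `T_y P` (as a set of vectors) at a point `y` on an open edge; empty if `y` is
on no open edge. -/
def tangent (P : Polygon) (y : Plane) : Set Plane :=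
  {w | ∃ i, y ∈ P.edge i ∧ ∃ t : ℝ, w = t • (P.vertex (i + 1) - P.vertex i)}

end Polygon

/-- A pair of polygons `(P₋, P₊)`; `false` stands for the sign `-` and `true` for `+`. -/
abbrev PolygonPair : Type := Bool → Polygon

/-- A point of a disjoint union of two subsets of the plane: a sign together with a point. -/
abbrev TablePoint : Type := Bool × Plane

/-- `(s, x, y)` stands for the pair `(x, y)`, with `x` on the polygon of sign `s` and `y` on the
polygon of the opposite sign. -/
abbrev PhasePoint : Type := Bool × Plane × Plane

/-- The set `(P₋ × P₊) ⊔ (P₊ × P₋)`. -/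
def pairs (T : PolygonPair) : Set PhasePoint :=
  {p | p.2.1 ∈ (T p.1).curve ∧ p.2.2 ∈ (T (!p.1)).curve}

/-- The set of vertices of `P₋ ⊔ P₊`. -/
def vertexSet (T : PolygonPair) : Set TablePoint := {q | q.2 ∈ (T q.1).vertices}

/-- `z` lies on `P_s` and on the line through `x` parallel to the tangent line at `y`, it is not
`x`, and the open segment `xz` lies in the interior of `P_s`; here `p = (s, x, y)`. -/
def IsReflection (T : PolygonPair) (p : PhasePoint) (z : Plane) : Prop :=
  z ∈ (T p.1).curve ∧ z - p.2.1 ∈ (T (!p.1)).tangent p.2.2 ∧ z ≠ p.2.1 ∧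
    openSegment ℝ p.2.1 z ⊆ (T p.1).interior

/-- The maximal phase space, on which the symplectic billiard map is defined. -/
def maxPhaseSpace (T : PolygonPair) : Set PhasePoint :=
  {p | p ∈ pairs T ∧ p.2.2 ∉ (T (!p.1)).vertices ∧ ∃! z, IsReflection T p z}

open Classical in
/-- The symplectic billiard map `(x, y) ↦ (y, z)` on the maximal phase space. Outside of it the map
is undefined, and the value is the argument by convention. (A point of the maximal phase space that
some iterate returns to itself therefore never leaves the maximal phase space.) -/
noncomputable def billiardMap (T : PolygonPair) (p : PhasePoint) : PhasePoint :=
  if h : p ∈ maxPhaseSpace T then (!p.1, p.2.2, h.2.2.choose) else p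

/-- `N₀ = (P₋ × V₊) ⊔ (P₊ × V₋)`, and `N_{i+1}` is the preimage of `N_i` under the billiard map,
which is defined on the maximal phase space only. -/
noncomputable def discontinuityLevel (T : PolygonPair) : ℕ → Set PhasePoint
  | 0 => {p | p ∈ pairs T ∧ p.2.2 ∈ (T (!p.1)).vertices}
  | i + 1 => {p | p ∈ maxPhaseSpace T ∧ billiardMap T p ∈ discontinuityLevel T i}

/-- The map `(x, y) ↦ (y, x)`. -/
def swap (p : PhasePoint) : PhasePoint := (!p.1, p.2.2, p.2.1)

/-- The discontinuity set `N`. -/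
def discontinuitySet (T : PolygonPair) : Set PhasePoint :=
  (⋃ i, discontinuityLevel T i) ∪ swap '' (⋃ i, discontinuityLevel T i)

/-- The phase space. -/
def phaseSpace (T : PolygonPair) : Set PhasePoint := maxPhaseSpace T \ discontinuitySet T

/-- The projection `(P₋ × P₊) ⊔ (P₊ × P₋) → P₋ ⊔ P₊` to the second factor. -/
def proj₂ (p : PhasePoint) : TablePoint := (!p.1, p.2.2)

/-- The projection `(P₋ × P₊) ⊔ (P₊ × P₋) → P₋ ⊔ P₊` to the first factor. -/
def proj₁ (p : PhasePoint) : TablePoint := (p.1, p.2.1)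

/-- The set `C ⊆ P₋ ⊔ P₊` of critical points. -/
def criticalSet (T : PolygonPair) : Set TablePoint :=
  ⋃ i : ℕ, proj₂ '' discontinuityLevel T (2 * i)

/-- The `k`-th point of the trajectory that starts at `p`. -/
noncomputable def trajectory (T : PolygonPair) (p : PhasePoint) (k : ℕ) : TablePoint :=
  proj₁ ((billiardMap T)^[k] p)

/-- `FP`: the pairs of polygons for which every orbit in the phase space is periodic. -/
def FP : Set PolygonPair :=
  {T | ∀ p ∈ phaseSpace T, p ∈ Function.periodicPts (billiardMap T)}

/-- `BP`: the pairs in `FP` for which there is a uniform upper bound on all periods. -/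
def BP : Set PolygonPair :=
  {T | T ∈ FP ∧ ∃ B : ℕ, ∀ p ∈ phaseSpace T, Function.minimalPeriod (billiardMap T) p ≤ B}

theorem not_collinear_of_det {a b c : Plane}
    (h : (b.1 - a.1) * (c.2 - a.2) - (b.2 - a.2) * (c.1 - a.1) ≠ 0) :
    ¬ Collinear ℝ {a, b, c} := by
  intro hc
  rw [collinear_iff_of_mem (p₀ := a) (by simp)] at hc
  obtain ⟨v, hv⟩ := hc
  obtain ⟨r, hr⟩ := hv b (by simp)
  obtain ⟨s, hs⟩ := hv c (by simp)
  apply h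
  rw [hr, hs]
  simp
  ring

/-- The cyclic sequence of points `a, b, c, d`. -/
def fourPoints (a b c d : Plane) : ZMod 4 → Plane := (![a, b, c, d] : Fin 4 → Plane)

theorem fourPoints_values (a b c d : Plane) :
    fourPoints a b c d 0 = a ∧ fourPoints a b c d 1 = b ∧ fourPoints a b c d 2 = c ∧
      fourPoints a b c d 3 = d := ⟨rfl, rfl, rfl, rfl⟩

theorem forall_zmod_four {p : ZMod 4 → Prop} (h0 : p 0) (h1 : p 1) (h2 : p 2) (h3 : p 3) :
    ∀ i, p i := by
  change ∀ i : Fin 4, p i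
  intro i
  fin_cases i
  exacts [h0, h1, h2, h3]

theorem zmod_four_add : ((0 : ZMod 4) + 1 = 1 ∧ (1 : ZMod 4) + 1 = 2 ∧ (2 : ZMod 4) + 1 = 3 ∧
    (3 : ZMod 4) + 1 = 0) ∧ ((0 : ZMod 4) + 2 = 2 ∧ (1 : ZMod 4) + 2 = 3 ∧
    (2 : ZMod 4) + 2 = 0 ∧ (3 : ZMod 4) + 2 = 1) := by decide

theorem mem_openSegment_plane {a b z : Plane} : z ∈ openSegment ℝ a b ↔
    ∃ s t : ℝ, 0 < s ∧ 0 < t ∧ s + t = 1 ∧ s * a.1 + t * b.1 = z.1 ∧ s * a.2 + t * b.2 = z.2 := by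
  simp [openSegment, Prod.ext_iff]

/-- The square with vertices `(0,0)`, `(4,0)`, `(4,4)`, `(0,4)`. -/
def square : Polygon where
  n := 4
  three_le := by norm_num
  vertex := fourPoints (0, 0) (4, 0) (4, 4) (0, 4)
  vertex_injective := by
    intro i j
    revert i j
    refine forall_zmod_four ?_ ?_ ?_ ?_ <;> refine forall_zmod_four ?_ ?_ ?_ ?_ <;>
      simp [fourPoints_values]
  edges_disjoint := by
    simp only [Set.disjoint_left, mem_openSegment_plane]
    refine forall_zmod_four ?_ ?_ ?_ ?_ <;> refine forall_zmod_four ?_ ?_ ?_ ?_ <;>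
      simp only [fourPoints_values, zmod_four_add] <;>
      first
      | (intro h; exact absurd rfl h)
      | (rintro - z ⟨s, t, hs, ht, hst, h1, h2⟩ ⟨s', t', hs', ht', hst', h1', h2'⟩; linarith)
  vertex_notMem_edge := by
    simp only [mem_openSegment_plane]
    refine forall_zmod_four ?_ ?_ ?_ ?_ <;> refine forall_zmod_four ?_ ?_ ?_ ?_ <;>
      simp only [fourPoints_values, zmod_four_add] <;>
      (rintro ⟨s, t, hs, ht, hst, h1, h2⟩; linarith)
  not_collinear := by
    refine forall_zmod_four ?_ ?_ ?_ ?_ <;> apply not_collinear_of_det <;>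
      simp only [fourPoints_values, zmod_four_add] <;> norm_num

/-- The rhombus with vertices `(6,5)`, `(8,1)`, `(12,-1)`, `(10,3)`. -/
def rhombus : Polygon where
  n := 4
  three_le := by norm_num
  vertex := fourPoints (6, 5) (8, 1) (12, -1) (10, 3)
  vertex_injective := by
    intro i j
    revert i j
    refine forall_zmod_four ?_ ?_ ?_ ?_ <;> refine forall_zmod_four ?_ ?_ ?_ ?_ <;>
      simp [fourPoints_values]
  edges_disjoint := by
    simp only [Set.disjoint_left, mem_openSegment_plane]
    refine forall_zmod_four ?_ ?_ ?_ ?_ <;> refine forall_zmod_four ?_ ?_ ?_ ?_ <;>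
      simp only [fourPoints_values, zmod_four_add] <;>
      first
      | (intro h; exact absurd rfl h)
      | (rintro - z ⟨s, t, hs, ht, hst, h1, h2⟩ ⟨s', t', hs', ht', hst', h1', h2'⟩; linarith)
  vertex_notMem_edge := by
    simp only [mem_openSegment_plane]
    refine forall_zmod_four ?_ ?_ ?_ ?_ <;> refine forall_zmod_four ?_ ?_ ?_ ?_ <;>
      simp only [fourPoints_values, zmod_four_add] <;>
      (rintro ⟨s, t, hs, ht, hst, h1, h2⟩; linarith)
  not_collinear := by
    refine forall_zmod_four ?_ ?_ ?_ ?_ <;> apply not_collinear_of_det <;>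
      simp only [fourPoints_values, zmod_four_add] <;> norm_num

/-- The pair `(P₋, P₊)` of the square and the rhombus. -/
def squareRhombus : PolygonPair := fun s => if s then rhombus else square

end SymplecticBilliard

/-! An affine chart turns each table into the square [0,4]², and in these coordinates the two tables
play the same role: a horizontal side of either one gives chords of slope -1/2 on the other, a
vertical side chords of slope -2. Let ξ be the distance of a boundary point to whichever of the
corners (0,0), (4,4) lies on its side. If the other point lies on a side of the same type,
reflection halves ξ. If the types differ, it doubles ξ when ξ ≤ 2, and otherwise crosses to the
opposite side with ξ ↦ 6 - ξ.

Write ξ = 2^m ρ with 1 ≤ ρ ≤ 2. Halving and doubling only shift m, and ξ > 2 forces m = 1, where 6 -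
ξ = 2(3 - ρ). So the mantissas stay in a finite set, and the sum of the two levels, plus 1 if the
types differ, is conserved (`levelInvariant_step`). Levels are at most 1, hence also bounded below:
an orbit visits finitely many states. Reflections are involutions, so the dynamics is injective and
the orbit periodic (`exists_iterate_step_eq`).

Coordinates 3/2^k have the mantissa 3/2 fixed by ρ ↦ 3 - ρ and never meet a vertex. They give orbits
arbitrarily close to (12,-1), with arbitrarily long periods (`iterate_step_even`). Pulling vertices
back gives exactly coordinates of the form 4/2^k (`dyadic_of_reflect`), infinitely many of which
occur; they accumulate only at ξ = 0, a corner. -/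

namespace SymplecticBilliard

/-! ### Common affine coordinates for the two tables -/

/-- The affine chart that carries the square `[0,4]²` onto the region bounded by the table of
sign `s`. -/
noncomputable def chart (s : Bool) (w : Plane) : Plane :=
  if s then (12 - w.1 - w.2 / 2, -1 + w.2 + w.1 / 2) else w

/-- A code `(side, type, ξ)` for a boundary point of `[0,4]²`: the side tells which of the corners
`(0,0)`, `(4,4)` the edge contains, the type whether the edge is vertical, and `ξ` is the distance
to that corner. -/
abbrev Code : Type := Bool × Bool × ℝ

/-- The boundary point of `[0,4]²` with a given code. -/
noncomputable def boundaryPoint : Code → Plane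
  | (false, false, ξ) => (ξ, 0)
  | (false, true, ξ) => (0, ξ)
  | (true, false, ξ) => (4 - ξ, 4)
  | (true, true, ξ) => (4, 4 - ξ)

/-- The point of the table of sign `s` with a given code. -/
noncomputable def tablePoint (s : Bool) (X : Code) : Plane := chart s (boundaryPoint X)

/-- The edge directions of the tables, by the type of the edge of the opposite table, in the
coordinates of `[0,4]²`. -/
noncomputable def direction (t : Bool) : Plane := if t then (1, -2) else (2, -1)

/-- The reflection of a coded point in the direction given by an edge type of the other table. -/
noncomputable def reflect (u : Bool) : Code → Code
  | (a, t, ξ) =>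
    if u = t then (a, !t, ξ / 2) else if ξ ≤ 2 then (a, !t, 2 * ξ) else (!a, t, 6 - ξ)

theorem chart_injective (s : Bool) : Function.Injective (chart s) := by
  rintro ⟨a, b⟩ ⟨c, d⟩ h
  cases s <;> simp only [chart, Prod.mk.injEq, if_true, if_false, Bool.false_eq_true] at h ⊢ <;>
    constructor <;> linarith [h.1, h.2]

theorem boundaryPoint_inj {X Y : Code} (hX : 0 < X.2.2 ∧ X.2.2 < 4) (hY : 0 < Y.2.2 ∧ Y.2.2 < 4)
    (h : boundaryPoint X = boundaryPoint Y) : X = Y := by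
  obtain ⟨a, t, ξ⟩ := X
  obtain ⟨b, u, η⟩ := Y
  obtain ⟨h1, h2⟩ := hX
  obtain ⟨h3, h4⟩ := hY
  dsimp only at h1 h2 h3 h4
  cases a <;> cases t <;> cases b <;> cases u <;>
    simp only [boundaryPoint, Prod.mk.injEq] at h ⊢ <;> obtain ⟨h5, h6⟩ := h <;>
    first
    | (exfalso; linarith)
    | exact ⟨trivial, trivial, by linarith⟩

theorem tablePoint_inj {s : Bool} {X Y : Code} (hX : 0 < X.2.2 ∧ X.2.2 < 4)
    (hY : 0 < Y.2.2 ∧ Y.2.2 < 4) (h : tablePoint s X = tablePoint s Y) : X = Y :=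
  boundaryPoint_inj hX hY (chart_injective s h)

theorem exists_zmod_four {p : ZMod 4 → Prop} : (∃ i, p i) ↔ p 0 ∨ p 1 ∨ p 2 ∨ p 3 := by
  constructor
  · rintro ⟨i, hi⟩
    revert i
    refine forall_zmod_four ?_ ?_ ?_ ?_ <;> tauto
  · rintro (h | h | h | h) <;> exact ⟨_, h⟩

theorem mem_segment_plane {a b z : Plane} : z ∈ segment ℝ a b ↔
    ∃ s t : ℝ, 0 ≤ s ∧ 0 ≤ t ∧ s + t = 1 ∧ s * a.1 + t * b.1 = z.1 ∧ s * a.2 + t * b.2 = z.2 := by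
  simp [segment, Prod.ext_iff]

theorem exists_code {p : Code → Prop} : (∃ X, p X) ↔
    (∃ ξ, p (false, false, ξ)) ∨ (∃ ξ, p (true, true, ξ)) ∨ (∃ ξ, p (true, false, ξ)) ∨
      ∃ ξ, p (false, true, ξ) := by
  constructor
  · rintro ⟨⟨a, t, ξ⟩, h⟩
    cases a <;> cases t <;> tauto
  · rintro (⟨ξ, h⟩ | ⟨ξ, h⟩ | ⟨ξ, h⟩ | ⟨ξ, h⟩) <;> exact ⟨_, h⟩

theorem mem_curve_square {z : Plane} : z ∈ square.curve ↔
    ∃ X : Code, (0 ≤ X.2.2 ∧ X.2.2 ≤ 4) ∧ z = tablePoint false X := by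
  obtain ⟨x, y⟩ := z
  simp only [Polygon.curve, mem_iUnion]
  refine (exists_zmod_four (p := fun i => (x, y) ∈ segment ℝ (square.vertex i)
    (square.vertex (i + 1 : ZMod 4)))).trans ?_
  simp only [square, fourPoints_values, zmod_four_add, mem_segment_plane, exists_code, tablePoint,
    chart, boundaryPoint, Prod.mk.injEq, Bool.false_eq_true, if_false]
  refine or_congr ?_ (or_congr ?_ (or_congr ?_ ?_)) <;> constructor
  · rintro ⟨s, t, h1, h2, h3, h4, h5⟩
    exact ⟨x, ⟨by linarith, by linarith⟩, by linarith, by linarith⟩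
  · rintro ⟨ξ, ⟨h1, h2⟩, h3, h4⟩
    exact ⟨1 - ξ / 4, ξ / 4, by linarith, by linarith, by linarith, by linarith, by linarith⟩
  · rintro ⟨s, t, h1, h2, h3, h4, h5⟩
    exact ⟨4 - y, ⟨by linarith, by linarith⟩, by linarith, by linarith⟩
  · rintro ⟨ξ, ⟨h1, h2⟩, h3, h4⟩
    exact ⟨ξ / 4, 1 - ξ / 4, by linarith, by linarith, by linarith, by linarith, by linarith⟩
  · rintro ⟨s, t, h1, h2, h3, h4, h5⟩
    exact ⟨4 - x, ⟨by linarith, by linarith⟩, by linarith, by linarith⟩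
  · rintro ⟨ξ, ⟨h1, h2⟩, h3, h4⟩
    exact ⟨1 - ξ / 4, ξ / 4, by linarith, by linarith, by linarith, by linarith, by linarith⟩
  · rintro ⟨s, t, h1, h2, h3, h4, h5⟩
    exact ⟨y, ⟨by linarith, by linarith⟩, by linarith, by linarith⟩
  · rintro ⟨ξ, ⟨h1, h2⟩, h3, h4⟩
    exact ⟨ξ / 4, 1 - ξ / 4, by linarith, by linarith, by linarith, by linarith, by linarith⟩

theorem mem_curve_rhombus {z : Plane} : z ∈ rhombus.curve ↔
    ∃ X : Code, (0 ≤ X.2.2 ∧ X.2.2 ≤ 4) ∧ z = tablePoint true X := by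
  obtain ⟨x, y⟩ := z
  simp only [Polygon.curve, mem_iUnion]
  refine (exists_zmod_four (p := fun i => (x, y) ∈ segment ℝ (rhombus.vertex i)
    (rhombus.vertex (i + 1 : ZMod 4)))).trans ?_
  -- The chart reverses orientation: the sides of the rhombus come in the order right, bottom, left,
  -- top of the chart square.
  have h : ∀ {a b c d : Prop}, (a ∨ b ∨ c ∨ d) ↔ (b ∨ a ∨ d ∨ c) := by tauto
  rw [h]
  simp only [rhombus, fourPoints_values, zmod_four_add, mem_segment_plane, exists_code, tablePoint,
    chart, boundaryPoint, Prod.mk.injEq, if_true]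
  refine or_congr ?_ (or_congr ?_ (or_congr ?_ ?_)) <;> constructor
  · rintro ⟨s, t, h1, h2, h3, h4, h5⟩
    exact ⟨4 * s, ⟨by linarith, by linarith⟩, by linarith, by linarith⟩
  · rintro ⟨ξ, ⟨h1, h2⟩, h3, h4⟩
    exact ⟨ξ / 4, 1 - ξ / 4, by linarith, by linarith, by linarith, by linarith, by linarith⟩
  · rintro ⟨s, t, h1, h2, h3, h4, h5⟩
    exact ⟨4 * t, ⟨by linarith, by linarith⟩, by linarith, by linarith⟩
  · rintro ⟨ξ, ⟨h1, h2⟩, h3, h4⟩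
    exact ⟨1 - ξ / 4, ξ / 4, by linarith, by linarith, by linarith, by linarith, by linarith⟩
  · rintro ⟨s, t, h1, h2, h3, h4, h5⟩
    exact ⟨4 * s, ⟨by linarith, by linarith⟩, by linarith, by linarith⟩
  · rintro ⟨ξ, ⟨h1, h2⟩, h3, h4⟩
    exact ⟨ξ / 4, 1 - ξ / 4, by linarith, by linarith, by linarith, by linarith, by linarith⟩
  · rintro ⟨s, t, h1, h2, h3, h4, h5⟩
    exact ⟨4 * t, ⟨by linarith, by linarith⟩, by linarith, by linarith⟩
  · rintro ⟨ξ, ⟨h1, h2⟩, h3, h4⟩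
    exact ⟨1 - ξ / 4, ξ / 4, by linarith, by linarith, by linarith, by linarith, by linarith⟩

theorem mem_curve {s : Bool} {z : Plane} : z ∈ (squareRhombus s).curve ↔
    ∃ X : Code, (0 ≤ X.2.2 ∧ X.2.2 ≤ 4) ∧ z = tablePoint s X := by
  cases s
  exacts [mem_curve_square, mem_curve_rhombus]

theorem mem_vertices {s : Bool} {z : Plane} : z ∈ (squareRhombus s).vertices ↔
    z = chart s (0, 0) ∨ z = chart s (4, 0) ∨ z = chart s (4, 4) ∨ z = chart s (0, 4) := by
  obtain ⟨x, y⟩ := z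
  cases s
  · refine (exists_zmod_four (p := fun i => square.vertex i = (x, y))).trans ?_
    simp [square, fourPoints_values, chart, eq_comm]
  · refine (exists_zmod_four (p := fun i => rhombus.vertex i = (x, y))).trans ?_
    simp only [rhombus, fourPoints_values, chart, Prod.mk.injEq, if_true]
    norm_num [eq_comm]
    tauto

theorem tablePoint_mem_vertices {s : Bool} {X : Code} (h : X.2.2 = 0 ∨ X.2.2 = 4) :
    tablePoint s X ∈ (squareRhombus s).vertices := by
  obtain ⟨a, t, ξ⟩ := X
  dsimp only at h
  rw [mem_vertices]
  rcases h with rfl | rfl <;> cases a <;> cases t <;> simp [tablePoint, boundaryPoint]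

theorem tablePoint_notMem_vertices {s : Bool} {X : Code} (h : 0 < X.2.2 ∧ X.2.2 < 4) :
    tablePoint s X ∉ (squareRhombus s).vertices := by
  obtain ⟨a, t, ξ⟩ := X
  obtain ⟨h1, h2⟩ := h
  dsimp only at h1 h2
  simp only [mem_vertices, tablePoint, (chart_injective s).eq_iff]
  cases a <;> cases t <;> simp only [boundaryPoint, Prod.mk.injEq] <;>
    rintro (⟨h3, h4⟩ | ⟨h3, h4⟩ | ⟨h3, h4⟩ | ⟨h3, h4⟩) <;> linarith

theorem exists_tablePoint {s : Bool} {z : Plane} (hz : z ∈ (squareRhombus s).curve)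
    (hv : z ∉ (squareRhombus s).vertices) :
    ∃ X : Code, (0 < X.2.2 ∧ X.2.2 < 4) ∧ z = tablePoint s X := by
  obtain ⟨X, ⟨h0, h4⟩, rfl⟩ := mem_curve.1 hz
  refine ⟨X, ⟨lt_of_le_of_ne h0 ?_, lt_of_le_of_ne h4 ?_⟩, rfl⟩ <;> intro h
  exacts [hv (tablePoint_mem_vertices (Or.inl h.symm)), hv (tablePoint_mem_vertices (Or.inr h))]

/-- The edge containing a coded point gives the direction of its type. -/
theorem mem_tangent {s : Bool} {X : Code} (hX : 0 < X.2.2 ∧ X.2.2 < 4) {w : Plane} :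
    w ∈ (squareRhombus s).tangent (tablePoint s X) ↔
      ∃ c : ℝ, w = chart (!s) (c • direction X.2.1) - chart (!s) 0 := by
  obtain ⟨a, t, ξ⟩ := X
  obtain ⟨x, y⟩ := w
  obtain ⟨h1, h2⟩ := hX
  dsimp only at h1 h2
  cases s
  · refine (exists_zmod_four (p := fun i => tablePoint false (a, t, ξ) ∈
      openSegment ℝ (square.vertex i) (square.vertex (i + 1 : ZMod 4)) ∧
      ∃ r : ℝ, (x, y) = r • (square.vertex (i + 1 : ZMod 4) - square.vertex i))).trans ?_
    simp only [square, fourPoints_values, zmod_four_add, mem_openSegment_plane,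
      tablePoint, chart, direction, Bool.not_false, if_true, Bool.false_eq_true, if_false]
    constructor
    · rintro (⟨⟨p, q, h3, h4, h5, h6, h7⟩, r, hr⟩ | ⟨⟨p, q, h3, h4, h5, h6, h7⟩, r, hr⟩ |
        ⟨⟨p, q, h3, h4, h5, h6, h7⟩, r, hr⟩ | ⟨⟨p, q, h3, h4, h5, h6, h7⟩, r, hr⟩) <;>
      cases a <;> cases t <;> simp only [boundaryPoint, Prod.ext_iff, Prod.fst_sub, Prod.snd_sub, Prod.smul_fst,
        Prod.smul_snd, smul_eq_mul, Prod.fst_zero, Prod.snd_zero, if_true, if_false, Bool.false_eq_true] at h6 h7 hr ⊢ <;>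
      first
      | (exfalso; linarith)
      -- The linear part of the chart sends (2,-1) to (-3/2,0) and (1,-2) to (0,-3/2); the sides of
      -- the square have length 4, whence 8/3.
      | exact ⟨- r * 8 / 3, by linarith, by linarith⟩
      | exact ⟨r * 8 / 3, by linarith, by linarith⟩
    · rintro ⟨c, hc⟩
      cases a <;> cases t <;> simp only [boundaryPoint, Prod.ext_iff, Prod.fst_sub, Prod.snd_sub, Prod.smul_fst,
        Prod.smul_snd, smul_eq_mul, Prod.fst_zero, Prod.snd_zero, if_true, if_false, Bool.false_eq_true] at hc ⊢
      · exact Or.inl ⟨⟨1 - ξ / 4, ξ / 4, by linarith, by linarith, by linarith, by linarith,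
          by linarith⟩, -c * 3 / 8, by linarith, by linarith⟩
      · exact Or.inr (Or.inr (Or.inr ⟨⟨ξ / 4, 1 - ξ / 4, by linarith, by linarith, by linarith, by linarith,
          by linarith⟩, c * 3 / 8, by linarith, by linarith⟩))
      · exact Or.inr (Or.inr (Or.inl ⟨⟨1 - ξ / 4, ξ / 4, by linarith, by linarith, by linarith, by linarith,
          by linarith⟩, c * 3 / 8, by linarith, by linarith⟩))
      · exact Or.inr (Or.inl ⟨⟨ξ / 4, 1 - ξ / 4, by linarith, by linarith, by linarith, by linarith,
          by linarith⟩, -c * 3 / 8, by linarith, by linarith⟩)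
  · refine (exists_zmod_four (p := fun i => tablePoint true (a, t, ξ) ∈
      openSegment ℝ (rhombus.vertex i) (rhombus.vertex (i + 1 : ZMod 4)) ∧
      ∃ r : ℝ, (x, y) = r • (rhombus.vertex (i + 1 : ZMod 4) - rhombus.vertex i))).trans ?_
    simp only [rhombus, fourPoints_values, zmod_four_add, mem_openSegment_plane,
      tablePoint, chart, direction, Bool.not_true, if_true, Bool.false_eq_true, if_false]
    constructor
    · rintro (⟨⟨p, q, h3, h4, h5, h6, h7⟩, r, hr⟩ | ⟨⟨p, q, h3, h4, h5, h6, h7⟩, r, hr⟩ |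
        ⟨⟨p, q, h3, h4, h5, h6, h7⟩, r, hr⟩ | ⟨⟨p, q, h3, h4, h5, h6, h7⟩, r, hr⟩) <;>
      cases a <;> cases t <;> simp only [boundaryPoint, Prod.ext_iff, Prod.fst_sub, Prod.snd_sub, Prod.smul_fst,
        Prod.smul_snd, smul_eq_mul, Prod.fst_zero, Prod.snd_zero, if_true, if_false, Bool.false_eq_true] at h6 h7 hr ⊢ <;>
      first
      | (exfalso; linarith)
      | exact ⟨2 * r, by linarith, by linarith⟩
      | exact ⟨-(2 * r), by linarith, by linarith⟩
    · rintro ⟨c, hc⟩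
      cases a <;> cases t <;> simp only [boundaryPoint, Prod.ext_iff, Prod.fst_sub, Prod.snd_sub, Prod.smul_fst,
        Prod.smul_snd, smul_eq_mul, Prod.fst_zero, Prod.snd_zero, if_true, if_false, Bool.false_eq_true] at hc ⊢
      · exact Or.inr (Or.inl ⟨⟨ξ / 4, 1 - ξ / 4, by linarith, by linarith, by linarith, by linarith,
          by linarith⟩, c / 2, by linarith, by linarith⟩)
      · exact Or.inr (Or.inr (Or.inl ⟨⟨1 - ξ / 4, ξ / 4, by linarith, by linarith, by linarith, by linarith,
          by linarith⟩, -c / 2, by linarith, by linarith⟩))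
      · exact Or.inr (Or.inr (Or.inr ⟨⟨ξ / 4, 1 - ξ / 4, by linarith, by linarith, by linarith, by linarith,
          by linarith⟩, -c / 2, by linarith, by linarith⟩))
      · exact Or.inl ⟨⟨1 - ξ / 4, ξ / 4, by linarith, by linarith, by linarith, by linarith,
          by linarith⟩, c / 2, by linarith, by linarith⟩

/-! ### Interiors of the tables -/

/-- The inverse of the chart. -/
noncomputable def unchart (s : Bool) (z : Plane) : Plane :=
  if s then (2 / 3 * (23 - 2 * z.1 - z.2), 2 / 3 * (z.1 + 2 * z.2 - 10)) else z

theorem chart_unchart (s : Bool) (z : Plane) : chart s (unchart s z) = z := by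
  obtain ⟨x, y⟩ := z
  cases s <;> simp only [chart, unchart, if_true, if_false, Bool.false_eq_true, Prod.mk.injEq]
  constructor <;> ring

theorem unchart_chart (s : Bool) (w : Plane) : unchart s (chart s w) = w :=
  chart_injective s (chart_unchart s _)

theorem continuous_chart (s : Bool) : Continuous (chart s) := by
  unfold chart
  cases s <;> simp only [if_true, if_false, Bool.false_eq_true] <;> fun_prop

theorem continuous_unchart (s : Bool) : Continuous (unchart s) := by
  unfold unchart
  cases s <;> simp only [if_true, if_false, Bool.false_eq_true] <;> fun_prop

theorem tablePoint_mem_curve {s : Bool} {X : Code} (h : 0 ≤ X.2.2 ∧ X.2.2 ≤ 4) :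
    tablePoint s X ∈ (squareRhombus s).curve := mem_curve.2 ⟨X, h, rfl⟩

/-- The images of the open square and of the complement of the closed square are disjoint open sets
covering the complement of the curve. A component meeting the first, bounded one is trapped in it.
-/
theorem chart_mem_interior {s : Bool} {w : Plane} (hw : w ∈ (Ioo (0 : ℝ) 4 ×ˢ Ioo (0 : ℝ) 4 : Set Plane)) :
    chart s w ∈ (squareRhombus s).interior := by
  set U : Set Plane := unchart s ⁻¹' (Ioo (0 : ℝ) 4 ×ˢ Ioo (0 : ℝ) 4) with hU
  set V : Set Plane := unchart s ⁻¹' (Icc (0 : ℝ) 4 ×ˢ Icc (0 : ℝ) 4)ᶜ with hV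
  have hUo : IsOpen U := (isOpen_Ioo.prod isOpen_Ioo).preimage (continuous_unchart s)
  have hVo : IsOpen V :=
    (isClosed_Icc.prod isClosed_Icc).isOpen_compl.preimage (continuous_unchart s)
  have hUV : Disjoint U V := by
    refine Disjoint.preimage _ (disjoint_compl_right_iff_subset.2 ?_)
    exact prod_mono Ioo_subset_Icc_self Ioo_subset_Icc_self
  have hmem : chart s w ∈ U := by
    change unchart s (chart s w) ∈ (Ioo (0 : ℝ) 4 ×ˢ Ioo (0 : ℝ) 4 : Set Plane)
    rwa [unchart_chart]
  have hcurve : chart s w ∈ (squareRhombus s).curveᶜ := by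
    rintro h
    obtain ⟨⟨a, t, ξ⟩, ⟨h1, h2⟩, h3⟩ := mem_curve.1 h
    have := chart_injective s h3
    subst this
    obtain ⟨⟨h4, h5⟩, h6, h7⟩ := hw
    cases a <;> cases t <;> simp only [boundaryPoint] at h4 h5 h6 h7 <;> linarith
  have hcover : (squareRhombus s).curveᶜ ⊆ U ∪ V := by
    intro z hz
    by_contra hzn
    apply hz
    rw [← chart_unchart s z]
    simp only [hU, hV, mem_union, mem_preimage, not_or, mem_compl_iff, not_not, mem_prod, mem_Icc,
      mem_Ioo] at hzn
    generalize unchart s z = v at hzn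
    obtain ⟨a, b⟩ := v
    obtain ⟨h0, ⟨h1, h2⟩, h3, h4⟩ := hzn
    dsimp only at h0 h1 h2 h3 h4
    rcases h1.eq_or_lt with rfl | h1
    · exact mem_curve.2 ⟨(false, true, b), ⟨h3, h4⟩, rfl⟩
    rcases h3.eq_or_lt with rfl | h3
    · exact mem_curve.2 ⟨(false, false, a), ⟨h1.le, h2⟩, rfl⟩
    rcases h2.eq_or_lt with rfl | h2
    · exact mem_curve.2 ⟨(true, true, 4 - b), ⟨by dsimp; linarith, by dsimp; linarith⟩,
        by simp [tablePoint, boundaryPoint]⟩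
    rcases h4.eq_or_lt with rfl | h4
    · exact mem_curve.2 ⟨(true, false, 4 - a), ⟨by dsimp; linarith, by dsimp; linarith⟩,
        by simp [tablePoint, boundaryPoint]⟩
    exact absurd ⟨⟨h1, h2⟩, h3, h4⟩ h0
  refine ⟨hcurve, ?_⟩
  have hsub : connectedComponentIn (squareRhombus s).curveᶜ (chart s w) ⊆ U :=
    isPreconnected_connectedComponentIn.subset_left_of_subset_union hUo hVo hUV
      ((connectedComponentIn_subset _ _).trans hcover)
      ⟨_, mem_connectedComponentIn hcurve, hmem⟩
  refine Bornology.IsBounded.subset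
    (((isCompact_Icc.prod isCompact_Icc).image (continuous_chart s)).isBounded
      (s := chart s '' (Icc (0 : ℝ) 4 ×ˢ Icc (0 : ℝ) 4))) (hsub.trans ?_)
  intro z hz
  exact ⟨unchart s z, prod_mono Ioo_subset_Icc_self Ioo_subset_Icc_self hz, chart_unchart s z⟩

theorem chart_openSegment {s : Bool} {v w z : Plane}
    (hz : z ∈ openSegment ℝ (chart s v) (chart s w)) : ∃ u ∈ openSegment ℝ v w, z = chart s u := by
  rw [mem_openSegment_plane] at hz
  obtain ⟨a, b, ha, hb, hab, h1, h2⟩ := hz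
  refine ⟨a • v + b • w, ⟨a, b, ha, hb, hab, rfl⟩, ?_⟩
  obtain rfl : b = 1 - a := by linarith
  obtain ⟨x, y⟩ := z
  cases s <;>
    simp only [chart, Prod.ext_iff, Prod.fst_add, Prod.snd_add, Prod.smul_fst, Prod.smul_snd,
      smul_eq_mul, if_true, if_false, Bool.false_eq_true] at h1 h2 ⊢ <;>
    constructor <;> linarith

/-! ### Chords and reflections -/

theorem openSegment_reflect_subset {u : Bool} {X : Code} (hX : 0 < X.2.2 ∧ X.2.2 < 4) :
    openSegment ℝ (boundaryPoint X) (boundaryPoint (reflect u X)) ⊆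
      Ioo (0 : ℝ) 4 ×ˢ Ioo (0 : ℝ) 4 := by
  rintro ⟨x, y⟩ hz
  rw [mem_openSegment_plane] at hz
  obtain ⟨p, q, hp, hq, hpq, h1, h2⟩ := hz
  obtain ⟨a, t, ξ⟩ := X
  obtain ⟨h3, h4⟩ := hX
  dsimp only at h1 h2 h3 h4
  obtain rfl : p = 1 - q := by linarith
  have h5 : 0 < q * ξ := by positivity
  have h6 : 0 < (1 - q) * ξ := by positivity
  have h7 : 0 < q * (4 - ξ) := mul_pos hq (by linarith)
  have h8 : 0 < (1 - q) * (4 - ξ) := mul_pos hp (by linarith)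
  have h9 : ξ ≤ 2 → 0 ≤ q * (2 - ξ) := fun h => mul_nonneg hq.le (by linarith)
  simp only [mem_prod, mem_Ioo]
  by_cases hξ : ξ ≤ 2
  · specialize h9 hξ
    cases a <;> cases t <;> cases u <;>
      simp only [reflect, boundaryPoint, hξ, if_true, if_false, Bool.false_eq_true, Bool.true_eq_false,
        Bool.not_true, Bool.not_false] at h1 h2 <;>
      refine ⟨⟨?_, ?_⟩, ?_, ?_⟩ <;> nlinarith
  · cases a <;> cases t <;> cases u <;>
      simp only [reflect, boundaryPoint, hξ, if_true, if_false, Bool.false_eq_true, Bool.true_eq_false,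
        Bool.not_true, Bool.not_false] at h1 h2 <;>
      refine ⟨⟨?_, ?_⟩, ?_, ?_⟩ <;> nlinarith

/-- The value 4 occurs, from ξ = 2, but 0 never does: an orbit can only run into the corners (4,0)
and (0,4) of the chart square. -/
theorem reflect_mem {u : Bool} {X : Code} (hX : 0 < X.2.2 ∧ X.2.2 < 4) :
    0 < (reflect u X).2.2 ∧ (reflect u X).2.2 ≤ 4 := by
  obtain ⟨a, t, ξ⟩ := X
  obtain ⟨h3, h4⟩ := hX
  dsimp only at h3 h4
  simp only [reflect]
  split_ifs <;> constructor <;> dsimp only <;> linarith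

theorem boundaryPoint_reflect {u : Bool} {X : Code} :
    ∃ c : ℝ, boundaryPoint (reflect u X) = boundaryPoint X + c • direction u := by
  obtain ⟨a, t, ξ⟩ := X
  by_cases hξ : ξ ≤ 2 <;> cases a <;> cases t <;> cases u <;>
    simp only [reflect, boundaryPoint, direction, hξ, if_true, if_false, Bool.false_eq_true,
      Bool.true_eq_false, Bool.not_true, Bool.not_false, Prod.ext_iff, Prod.fst_add, Prod.snd_add,
      Prod.smul_fst, Prod.smul_snd, smul_eq_mul] <;>
    first
    | exact ⟨-ξ / 2, by ring1, by ring1⟩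
    | exact ⟨ξ / 2, by ring1, by ring1⟩
    | exact ⟨ξ, by ring1, by ring1⟩
    | exact ⟨-ξ, by ring1, by ring1⟩
    | exact ⟨2, by ring1, by ring1⟩
    | exact ⟨-2, by ring1, by ring1⟩

/-- The line is parallel to no side, so it meets the boundary in at most one further point. Points
are compared rather than codes because a corner has two codes. -/
theorem eq_reflect {u : Bool} {X Y : Code} (hX : 0 < X.2.2 ∧ X.2.2 < 4)
    (hY : 0 ≤ Y.2.2 ∧ Y.2.2 ≤ 4) {c : ℝ}
    (h : boundaryPoint Y = boundaryPoint X + c • direction u) (hne : boundaryPoint Y ≠ boundaryPoint X) :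
    boundaryPoint Y = boundaryPoint (reflect u X) := by
  have hc : c ≠ 0 := by
    rintro rfl
    exact hne (by simpa using h)
  obtain ⟨a, t, ξ⟩ := X
  obtain ⟨b, v, η⟩ := Y
  obtain ⟨h1, h2⟩ := hX
  obtain ⟨h3, h4⟩ := hY
  clear hne
  dsimp only at h1 h2 h3 h4
  by_cases hξ : ξ ≤ 2 <;> cases a <;> cases t <;> cases u <;> cases b <;> cases v <;>
    simp only [reflect, boundaryPoint, direction, hξ, if_true, if_false, Bool.false_eq_true,
      Bool.true_eq_false, Bool.not_true, Bool.not_false, Prod.ext_iff, Prod.fst_add, Prod.snd_add,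
      Prod.smul_fst, Prod.smul_snd, smul_eq_mul] at h ⊢ <;>
    obtain ⟨h5, h6⟩ := h <;>
    first
    | (exfalso; linarith)
    | (exact absurd (by linarith) hc)
    | (constructor <;> first | trivial | linarith)

/-! ### The billiard map on codes -/

/-- A coded phase point: a sign and the codes of the two points. -/
abbrev State : Type := Bool × Code × Code

/-- The phase point of a state. -/
noncomputable def toPhase (σ : State) : PhasePoint :=
  (σ.1, tablePoint σ.1 σ.2.1, tablePoint (!σ.1) σ.2.2)

/-- The symplectic billiard map on codes. -/
noncomputable def step (σ : State) : State := (!σ.1, σ.2.2, reflect σ.2.2.2.1 σ.2.1)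

/-- Neither of the two points is a vertex. -/
def Regular (σ : State) : Prop :=
  (0 < σ.2.1.2.2 ∧ σ.2.1.2.2 < 4) ∧ 0 < σ.2.2.2.2 ∧ σ.2.2.2.2 < 4

theorem eq_add_of_chart_sub {s : Bool} {u v w : Plane}
    (h : chart s v - chart s w = chart s u - chart s 0) : v = w + u := by
  obtain ⟨a, b⟩ := u
  obtain ⟨c, d⟩ := v
  obtain ⟨e, f⟩ := w
  cases s <;> simp only [chart, Prod.ext_iff, Prod.fst_sub, Prod.snd_sub, Prod.fst_add, Prod.snd_add,
    Prod.fst_zero, Prod.snd_zero, if_true, if_false, Bool.false_eq_true] at h ⊢ <;>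
    constructor <;> linarith [h.1, h.2]

theorem chart_add_sub {s : Bool} {u w : Plane} :
    chart s (w + u) - chart s w = chart s u - chart s 0 := by
  cases s <;> simp only [chart, Prod.ext_iff, Prod.fst_sub, Prod.snd_sub, Prod.fst_add, Prod.snd_add,
    Prod.fst_zero, Prod.snd_zero, if_true, if_false, Bool.false_eq_true] <;>
    constructor <;> ring

theorem boundaryPoint_reflect_ne {u : Bool} {X : Code} (hX : 0 < X.2.2 ∧ X.2.2 < 4) :
    boundaryPoint (reflect u X) ≠ boundaryPoint X := by
  obtain ⟨a, t, ξ⟩ := X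
  obtain ⟨h1, h2⟩ := hX
  dsimp only at h1 h2
  by_cases hξ : ξ ≤ 2 <;> cases a <;> cases t <;> cases u <;>
    simp only [reflect, boundaryPoint, hξ, if_true, if_false, Bool.false_eq_true, Bool.true_eq_false,
      Bool.not_true, Bool.not_false, ne_eq, Prod.mk.injEq] <;>
    rintro ⟨h3, h4⟩ <;> linarith

theorem isReflection_iff {σ : State} (h : Regular σ) {z : Plane} :
    IsReflection squareRhombus (toPhase σ) z ↔ z = tablePoint σ.1 (reflect σ.2.2.2.1 σ.2.1) := by
  obtain ⟨s, X, Y⟩ := σ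
  obtain ⟨hX, hY⟩ := h
  dsimp only at hX hY
  simp only [IsReflection, toPhase, mem_tangent hY, Bool.not_not]
  constructor
  · rintro ⟨hz, ⟨c, hc⟩, hne, -⟩
    obtain ⟨Z, hZ, rfl⟩ := mem_curve.1 hz
    have := eq_reflect hX hZ (eq_add_of_chart_sub hc) (fun h => hne (by rw [tablePoint, h, tablePoint]))
    rw [tablePoint, this, tablePoint]
  · rintro rfl
    refine ⟨tablePoint_mem_curve ⟨(reflect_mem hX).1.le, (reflect_mem hX).2⟩, ?_, ?_, ?_⟩
    · obtain ⟨c, hc⟩ := boundaryPoint_reflect (u := Y.2.1) (X := X)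
      exact ⟨c, by rw [tablePoint, tablePoint, hc, chart_add_sub]⟩
    · exact fun h => boundaryPoint_reflect_ne hX (chart_injective s h)
    · intro z hz
      obtain ⟨u, hu, rfl⟩ := chart_openSegment hz
      exact chart_mem_interior (openSegment_reflect_subset hX hu)

theorem toPhase_mem_maxPhaseSpace {σ : State} (h : Regular σ) :
    toPhase σ ∈ maxPhaseSpace squareRhombus := by
  refine ⟨⟨?_, ?_⟩, ?_, ?_⟩
  · exact tablePoint_mem_curve ⟨h.1.1.le, h.1.2.le⟩
  · exact tablePoint_mem_curve ⟨h.2.1.le, h.2.2.le⟩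
  · exact tablePoint_notMem_vertices h.2
  · exact ⟨_, (isReflection_iff h).2 rfl, fun _ hz => (isReflection_iff h).1 hz⟩

theorem billiardMap_toPhase {σ : State} (h : Regular σ) :
    billiardMap squareRhombus (toPhase σ) = toPhase (step σ) := by
  have hmem := toPhase_mem_maxPhaseSpace h
  rw [billiardMap, dif_pos hmem]
  have := (isReflection_iff h).1 (Exists.choose_spec hmem.2.2).1
  rw [this]
  simp [toPhase, step]

theorem iterate_billiardMap_toPhase {σ : State} (h : ∀ n, Regular (step^[n] σ)) (n : ℕ) :
    (billiardMap squareRhombus)^[n] (toPhase σ) = toPhase (step^[n] σ) := by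
  induction n with
  | zero => rfl
  | succ n ih => rw [Function.iterate_succ_apply', ih, billiardMap_toPhase (h n),
      Function.iterate_succ_apply']

/-- The chord is traversed backwards: halving and doubling invert each other, and 6 - ξ > 2 keeps
the third branch self-inverse. -/
theorem reflect_reflect {u : Bool} {X : Code} (hX : 0 < X.2.2 ∧ X.2.2 < 4)
    (h : (reflect u X).2.2 < 4) : reflect u (reflect u X) = X := by
  obtain ⟨a, t, ξ⟩ := X
  obtain ⟨h1, h2⟩ := hX
  dsimp only at h1 h2
  by_cases hut : u = t
  · subst hut
    have : ξ / 2 ≤ 2 := by linarith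
    simp [reflect, this]
    ring
  · have hut' : u = !t := by cases u <;> cases t <;> simp_all
    by_cases hξ : ξ ≤ 2
    · simp only [reflect, hut, hξ, if_true, if_false, ← hut', Prod.mk.injEq, true_and]
      refine ⟨by simp [hut'], by ring⟩
    · have : ¬ 6 - ξ ≤ 2 := by linarith
      simp [reflect, hut, hξ, this]

/-! ### The level invariant and periodicity -/

/-- The level of a coordinate, relative to a finite set of mantissas, is its binary exponent; the
sum of the two levels is invariant up to a correction given by the two types. -/
def LevelInvariant (R : Set ℝ) (Q : ℤ) (σ : State) : Prop :=
  ∃ m l : ℤ, m ≤ 1 ∧ l ≤ 1 ∧ (∃ ρ ∈ R, σ.2.1.2.2 = 2 ^ m * ρ) ∧ (∃ ρ ∈ R, σ.2.2.2.2 = 2 ^ l * ρ) ∧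
    m + l + (if σ.2.1.2.1 = σ.2.2.2.1 then 0 else 1) = Q

/-- Halving lowers a level by 1 and makes equal types different; doubling does the reverse; ξ ↦ 6 -
ξ changes ρ to 3 - ρ at level 1 and keeps the types. -/
theorem levelInvariant_step {R : Set ℝ} (hR : ∀ ρ ∈ R, 1 ≤ ρ ∧ ρ ≤ 2) (hR' : ∀ ρ ∈ R, 3 - ρ ∈ R)
    {Q : ℤ} {σ : State} (h : LevelInvariant R Q σ) (hσ : Regular σ) (hσ' : Regular (step σ)) :
    LevelInvariant R Q (step σ) := by
  obtain ⟨s, ⟨a, t, ξ⟩, b, u, η⟩ := σ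
  obtain ⟨m, l, hm, hl, ⟨ρ, hρ, hξ⟩, hη, hQ⟩ := h
  dsimp only at hξ hη hQ
  have h1 := hσ.1.1
  have h2 := hσ.1.2
  have h3 := hσ'.2.2
  have two_zpow : (2 : ℝ) ^ (1 : ℤ) = 2 := zpow_one 2
  simp only [step, reflect] at h1 h2 h3
  unfold LevelInvariant
  simp only [step, reflect]
  by_cases hut : u = t
  · subst hut
    refine ⟨l, m - 1, hl, by linarith, hη, ⟨ρ, hρ, ?_⟩, ?_⟩
    · simp only [if_true]
      rw [hξ, zpow_sub_one₀ two_ne_zero]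
      ring
    · simp only [if_true] at hQ ⊢
      simp only [Bool.eq_not_self, if_false]
      linarith
  · have hut' : u = !t := by cases u <;> cases t <;> simp_all
    rw [if_neg hut] at h3
    rw [if_neg (Ne.symm hut)] at hQ
    have hρ' := hR ρ hρ
    by_cases hξ2 : ξ ≤ 2
    · rw [if_pos hξ2] at h3
      dsimp only at h3
      -- Level 1 would mean ξ ≥ 2, so the image 2ξ would be at least 4, against regularity of the
      -- next state.
      have hm0 : m ≤ 0 := by
        by_contra hm0
        obtain rfl : m = 1 := by omega
        rw [two_zpow] at hξ
        linarith
      refine ⟨l, m + 1, hl, by linarith, hη, ⟨ρ, hρ, ?_⟩, ?_⟩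
      · rw [if_neg hut, if_pos hξ2]
        simp only
        rw [hξ, zpow_add_one₀ two_ne_zero]
        ring
      · simp only [if_neg hut, if_pos hξ2, if_pos hut']
        linarith
    · have hm1 : m = 1 := by
        by_contra hm1
        have : (2 : ℝ) ^ m ≤ 2 ^ (0 : ℤ) := zpow_le_zpow_right₀ one_le_two (by omega)
        rw [zpow_zero] at this
        nlinarith
      subst hm1
      refine ⟨l, 1, hl, le_rfl, hη, ⟨3 - ρ, hR' ρ hρ, ?_⟩, ?_⟩
      · rw [if_neg hut, if_neg hξ2]
        simp only
        rw [hξ, two_zpow]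
        ring
      · simp only [if_neg hut, if_neg hξ2]
        linarith

/-- From m + l ≥ Q - 1 and m, l ≤ 1, both levels lie in [Q - 2, 1]. -/
theorem finite_levelInvariant {R : Set ℝ} (hR : R.Finite) (Q : ℤ) :
    {σ | LevelInvariant R Q σ}.Finite := by
  have hW : (image2 (fun (m : ℤ) (ρ : ℝ) => (2 : ℝ) ^ m * ρ) (Icc (Q - 2) 1) R).Finite :=
    (finite_Icc _ _).image2 _ hR
  set W := image2 (fun (m : ℤ) (ρ : ℝ) => (2 : ℝ) ^ m * ρ) (Icc (Q - 2) 1) R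
  have hcode : ((univ : Set Bool) ×ˢ ((univ : Set Bool) ×ˢ W)).Finite :=
    finite_univ.prod (finite_univ.prod hW)
  refine ((finite_univ (α := Bool)).prod (hcode.prod hcode)).subset ?_
  rintro ⟨s, ⟨a, t, ξ⟩, b, u, η⟩ ⟨m, l, hm, hl, ⟨ρ, hρ, hξ⟩, ⟨ρ', hρ', hη⟩, hQ⟩
  dsimp only at hξ hη hQ
  have hml : Q - 1 ≤ m + l := by split_ifs at hQ <;> omega
  exact ⟨mem_univ _, ⟨mem_univ _, mem_univ _, m, ⟨by omega, hm⟩, ρ, hρ, hξ.symm⟩,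
    mem_univ _, mem_univ _, l, ⟨by omega, hl⟩, ρ', hρ', hη.symm⟩

/-- Binary exponents give ρ < 2, but only the closed interval [1,2] is stable under ρ ↦ 3 - ρ. -/
theorem exists_level {ξ : ℝ} (h : 0 < ξ ∧ ξ < 4) :
    ∃ m : ℤ, m ≤ 1 ∧ ∃ ρ : ℝ, (1 ≤ ρ ∧ ρ ≤ 2) ∧ ξ = 2 ^ m * ρ := by
  obtain ⟨m, h1, h2⟩ := exists_mem_Ico_zpow h.1 one_lt_two
  have hpos : (0 : ℝ) < 2 ^ m := by positivity
  refine ⟨m, ?_, ξ / 2 ^ m, ⟨?_, ?_⟩, by field_simp⟩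
  · have : (2 : ℝ) ^ m < 2 ^ (2 : ℤ) := by
      have h4 : (2 : ℝ) ^ (2 : ℤ) = 4 := by norm_num
      linarith [h.2]
    have := (zpow_lt_zpow_iff_right₀ (one_lt_two (α := ℝ))).1 this
    omega
  · rwa [le_div_iff₀ hpos, one_mul]
  · rw [div_le_iff₀ hpos]
    rw [zpow_add_one₀ two_ne_zero] at h2
    linarith

theorem exists_iterate_step_eq {σ : State} (h : ∀ n, Regular (step^[n] σ)) :
    ∃ d, 0 < d ∧ step^[d] σ = σ := by
  obtain ⟨m, hm, ρ, hρ, hξ⟩ := exists_level (h 0).1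
  obtain ⟨l, hl, ρ', hρ', hη⟩ := exists_level (h 0).2
  set R : Set ℝ := {ρ, 3 - ρ, ρ', 3 - ρ'} with hRdef
  have hR : ∀ r ∈ R, 1 ≤ r ∧ r ≤ 2 := by
    rintro r (rfl | rfl | rfl | rfl) <;> constructor <;> linarith [hρ.1, hρ.2, hρ'.1, hρ'.2]
  have hR' : ∀ r ∈ R, 3 - r ∈ R := by
    rintro r (rfl | rfl | rfl | rfl) <;> simp [hRdef]
  have hRf : R.Finite := by simp [hRdef]
  set Q : ℤ := m + l + (if σ.2.1.2.1 = σ.2.2.2.1 then 0 else 1) with hQ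
  have hinv : ∀ n, LevelInvariant R Q (step^[n] σ) := by
    intro n
    induction n with
    | zero => exact ⟨m, l, hm, hl, ⟨ρ, by simp [hRdef], hξ⟩, ⟨ρ', by simp [hRdef], hη⟩, rfl⟩
    | succ n ih =>
      have h' := h (n + 1)
      rw [Function.iterate_succ_apply'] at h' ⊢
      exact levelInvariant_step hR hR' ih (h n) h'
  set O : Set State := {τ | ∀ n, Regular (step^[n] τ)}
  have hmaps : MapsTo step O O := fun τ hτ n => by
    simpa only [Function.iterate_succ_apply] using hτ (n + 1)
  -- The step keeps Y, hence the direction, and reflecting once more recovers X.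
  have hinj : InjOn step O := by
    rintro ⟨s, X, Y⟩ hτ ⟨s', X', Y'⟩ hτ' heq
    simp only [step, Prod.mk.injEq, Bool.not_inj_iff] at heq
    obtain ⟨rfl, rfl, hr⟩ := heq
    have e1 : reflect Y.2.1 (reflect Y.2.1 X) = X := reflect_reflect (hτ 0).1 (hτ 1).2.2
    have e2 : reflect Y.2.1 (reflect Y.2.1 X') = X' := reflect_reflect (hτ' 0).1 (hτ' 1).2.2
    rw [← e1, ← e2, hr]
  obtain ⟨i, j, hij, he⟩ := (finite_levelInvariant hRf Q).exists_lt_map_eq_of_forall_mem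
    (f := fun n => step^[n] σ) hinv
  refine ⟨j - i, by omega, ?_⟩
  have hσ : σ ∈ O := h
  have hσ' : step^[j - i] σ ∈ O := hmaps.iterate _ hσ
  refine hinj.iterate hmaps i hσ' hσ ?_
  rw [← Function.iterate_add_apply, Nat.add_sub_cancel' hij.le]
  exact he.symm

/-! ### Orbits in the phase space avoid the vertices -/

theorem iterate_notMem_vertices {p : PhasePoint} {T : PolygonPair}
    (h : p ∉ ⋃ i, discontinuityLevel T i) (n : ℕ)
    (hmax : ∀ i < n, (billiardMap T)^[i] p ∈ maxPhaseSpace T)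
    (hpairs : (billiardMap T)^[n] p ∈ pairs T) :
    ((billiardMap T)^[n] p).2.2 ∉ (T (!((billiardMap T)^[n] p).1)).vertices := by
  intro hv
  apply h
  rw [mem_iUnion]
  refine ⟨n, ?_⟩
  clear h
  induction n generalizing p with
  | zero => exact ⟨hpairs, hv⟩
  | succ n ih =>
    exact ⟨hmax 0 n.succ_pos, ih (fun i hi => hmax (i + 1) (by omega)) hpairs hv⟩

theorem exists_state {p : PhasePoint} (hp : p ∈ phaseSpace squareRhombus) :
    ∃ σ : State, p = toPhase σ ∧ ∀ n, Regular (step^[n] σ) := by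
  obtain ⟨⟨⟨hx, hy⟩, hyv, -⟩, hN⟩ := hp
  obtain ⟨s, x, y⟩ := p
  dsimp only at hx hy hyv
  -- A vertex x would put the swapped pair into N₀.
  have hxv : x ∉ (squareRhombus s).vertices := fun hxv => hN <| Or.inr
    ⟨(!s, y, x), mem_iUnion.2 ⟨0, ⟨⟨hy, by simpa using hx⟩, by simpa using hxv⟩⟩, by simp [swap]⟩
  obtain ⟨X, hX, rfl⟩ := exists_tablePoint hx hxv
  obtain ⟨Y, hY, rfl⟩ := exists_tablePoint hy hyv
  refine ⟨(s, X, Y), rfl, ?_⟩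
  set σ : State := (s, X, Y) with hσ
  have hN' : toPhase σ ∉ ⋃ i, discontinuityLevel squareRhombus i := fun h => hN (Or.inl h)
  have key : ∀ n, Regular (step^[n] σ) ∧
      (billiardMap squareRhombus)^[n] (toPhase σ) = toPhase (step^[n] σ) := by
    intro n
    induction n using Nat.strong_induction_on with
    | _ n ih =>
      cases n with
      | zero => exact ⟨⟨hX, hY⟩, rfl⟩
      | succ n =>
        obtain ⟨hr, he⟩ := ih n n.lt_succ_self
        have he' : (billiardMap squareRhombus)^[n + 1] (toPhase σ) = toPhase (step^[n + 1] σ) := by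
          rw [Function.iterate_succ_apply', he, billiardMap_toPhase hr,
            Function.iterate_succ_apply']
        refine ⟨?_, he'⟩
        have hX' : 0 < (step^[n + 1] σ).2.2.2.2 ∧ (step^[n + 1] σ).2.2.2.2 ≤ 4 := by
          rw [Function.iterate_succ_apply']
          exact reflect_mem hr.1
        have hY' : 0 < (step^[n + 1] σ).2.1.2.2 ∧ (step^[n + 1] σ).2.1.2.2 < 4 := by
          rw [Function.iterate_succ_apply']
          exact hr.2
        -- The new coordinate can only fail by being 4; that is a vertex, which would put the
        -- starting point into N_{n+1}.
        refine ⟨hY', hX'.1, lt_of_le_of_ne hX'.2 fun h4 => ?_⟩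
        refine iterate_notMem_vertices hN' (n + 1) (fun i hi => ?_) ?_ ?_
        · rw [(ih i hi).2]
          exact toPhase_mem_maxPhaseSpace (ih i hi).1
        · rw [he']
          exact ⟨tablePoint_mem_curve ⟨hY'.1.le, hY'.2.le⟩,
            tablePoint_mem_curve ⟨hX'.1.le, hX'.2⟩⟩
        · rw [he']
          exact tablePoint_mem_vertices (Or.inr h4)
  exact fun n => (key n).1

theorem squareRhombus_mem_FP : squareRhombus ∈ FP := by
  intro p hp
  obtain ⟨σ, rfl, hσ⟩ := exists_state hp
  obtain ⟨d, hd, he⟩ := exists_iterate_step_eq hσ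
  exact Function.mk_mem_periodicPts hd ((iterate_billiardMap_toPhase hσ d).trans (by rw [he]))

/-! ### Orbits with arbitrarily long periods -/

/-- The coordinates `3 / 2 ^ k` are preserved by all reflections. -/
theorem reflect_three_div {u : Bool} {X : Code} (h : ∃ k : ℕ, X.2.2 = 3 / 2 ^ k) :
    ∃ k : ℕ, (reflect u X).2.2 = 3 / 2 ^ k := by
  obtain ⟨a, t, ξ⟩ := X
  obtain ⟨k, hk⟩ := h
  dsimp only at hk
  subst hk
  simp only [reflect]
  split_ifs with h1 h2
  · exact ⟨k + 1, by simp only [pow_succ]; field_simp⟩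
  · cases k with
    | zero => norm_num at h2
    | succ k => exact ⟨k, by simp only [pow_succ]; field_simp⟩
  -- Here ξ > 2 forces k = 0, and 6 - 3 = 3.
  · cases k with
    | zero => exact ⟨0, by norm_num⟩
    | succ k =>
      refine absurd ?_ h2
      have : (1 : ℝ) ≤ 2 ^ k := one_le_pow₀ one_le_two
      rw [pow_succ, div_le_iff₀ (by positivity)]
      linarith

theorem three_div_bounds (k : ℕ) : (0 : ℝ) < 3 / 2 ^ k ∧ (3 : ℝ) / 2 ^ k < 4 := by
  have : (1 : ℝ) ≤ 2 ^ k := one_le_pow₀ one_le_two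
  refine ⟨by positivity, ?_⟩
  rw [div_lt_iff₀ (by positivity)]
  linarith

theorem regular_iterate_of_three_div {σ : State} (hX : ∃ k : ℕ, σ.2.1.2.2 = 3 / 2 ^ k)
    (hY : ∃ k : ℕ, σ.2.2.2.2 = 3 / 2 ^ k) (n : ℕ) : Regular (step^[n] σ) := by
  induction n generalizing σ with
  | zero =>
    obtain ⟨k, hk⟩ := hX
    obtain ⟨l, hl⟩ := hY
    constructor
    · simpa only [Function.iterate_zero, id, hk] using three_div_bounds k
    · simpa only [Function.iterate_zero, id, hl] using three_div_bounds l
  | succ n ih => exact ih hY (reflect_three_div hX)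

theorem notMem_discontinuityLevel {σ : State} (h : ∀ n, Regular (step^[n] σ)) (n : ℕ) :
    toPhase σ ∉ discontinuityLevel squareRhombus n := by
  induction n generalizing σ with
  | zero => exact fun hσ => tablePoint_notMem_vertices (h 0).2 hσ.2
  | succ n ih =>
    rintro ⟨-, hσ⟩
    rw [billiardMap_toPhase (σ := σ) (h 0)] at hσ
    exact ih (fun n => h (n + 1)) hσ

theorem toPhase_mem_phaseSpace_of_three_div {σ : State} (hX : ∃ k : ℕ, σ.2.1.2.2 = 3 / 2 ^ k)
    (hY : ∃ k : ℕ, σ.2.2.2.2 = 3 / 2 ^ k) : toPhase σ ∈ phaseSpace squareRhombus := by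
  refine ⟨toPhase_mem_maxPhaseSpace (regular_iterate_of_three_div hX hY 0), ?_⟩
  rintro (h | ⟨q, h, hq⟩)
  · obtain ⟨n, hn⟩ := mem_iUnion.1 h
    exact notMem_discontinuityLevel (regular_iterate_of_three_div hX hY) n hn
  · obtain ⟨n, hn⟩ := mem_iUnion.1 h
    obtain ⟨s, X, Y⟩ := σ
    have : q = toPhase (!s, Y, X) := by
      obtain ⟨s', x, y⟩ := q
      simp only [swap, toPhase, Prod.mk.injEq] at hq ⊢
      obtain ⟨rfl, rfl, rfl⟩ := hq
      simp
    rw [this] at hn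
    exact notMem_discontinuityLevel (regular_iterate_of_three_div (σ := (!s, Y, X)) hY hX) n hn

theorem step_step {s a b t : Bool} {ξ η : ℝ} (hη : η ≤ 2) :
    step (step (s, (a, t, ξ), b, t, η)) = (s, (a, !t, ξ / 2), b, !t, 2 * η) := by
  simp [step, reflect, hη]

/-- Equal types are restored after two steps, so the drift from one coordinate to the other repeats;
its length is what makes periods long. -/
theorem iterate_step_even {s a b t : Bool} {ξ η : ℝ} (j : ℕ) (hj : 2 ^ j * η ≤ 4) :
    ∃ t', step^[2 * j] (s, (a, t, ξ), b, t, η) = (s, (a, t', ξ / 2 ^ j), b, t', 2 ^ j * η) := by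
  induction j with
  | zero => exact ⟨t, by simp⟩
  | succ j ih =>
    rw [pow_succ] at hj
    obtain ⟨t', ht'⟩ := ih (by linarith)
    refine ⟨!t', ?_⟩
    rw [show 2 * (j + 1) = 2 * j + 1 + 1 by ring, Function.iterate_succ_apply',
      Function.iterate_succ_apply', ht', step_step (by linarith)]
    simp only [pow_succ, Prod.mk.injEq, true_and]
    constructor
    · field_simp
    · ring

theorem squareRhombus_notMem_BP : squareRhombus ∉ BP := by
  rintro ⟨hFP, B, hB⟩
  set σ : State := (false, (false, false, 3), false, false, 3 / 2 ^ B) with hσ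
  have hX : ∃ k : ℕ, σ.2.1.2.2 = 3 / 2 ^ k := ⟨0, by simp [hσ]⟩
  have hY : ∃ k : ℕ, σ.2.2.2.2 = 3 / 2 ^ k := ⟨B, rfl⟩
  have hmem := toPhase_mem_phaseSpace_of_three_div hX hY
  have hreg := regular_iterate_of_three_div hX hY
  set n := Function.minimalPeriod (billiardMap squareRhombus) (toPhase σ)
  have hpos : 0 < n := Function.minimalPeriod_pos_of_mem_periodicPts (hFP _ hmem)
  have hle : n ≤ B := hB _ hmem
  -- Doubling the period gives an even number of steps; since n ≤ B the drift has not stopped, and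
  -- the first coordinate is 3/2^n instead of 3.
  have hper : (billiardMap squareRhombus)^[2 * n] (toPhase σ) = toPhase σ :=
    (Function.isPeriodicPt_minimalPeriod _ _).const_mul 2
  rw [iterate_billiardMap_toPhase hreg] at hper
  have hpow : (2 : ℝ) ^ n ≤ 2 ^ B := pow_le_pow_right₀ one_le_two hle
  obtain ⟨t', ht'⟩ := iterate_step_even (s := false) (a := false) (b := false) (t := false)
    (ξ := 3) (η := 3 / 2 ^ B) n (by
      rw [mul_div_assoc', div_le_iff₀ (by positivity)]
      linarith [show (0 : ℝ) < 2 ^ B by positivity])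
  have hinj := tablePoint_inj (hreg (2 * n)).1 (hreg 0).1 (s := false)
    (by
      have h1 := congrArg (fun p => p.2.1) hper
      rw [hσ, ht'] at h1
      rw [hσ, ht']
      exact h1)
  rw [hσ, ht'] at hinj
  have h3 : (3 : ℝ) / 2 ^ n = 3 := congrArg (fun X => X.2.2) hinj
  have h2 : (2 : ℝ) ≤ 2 ^ n := by simpa using pow_le_pow_right₀ (one_le_two (α := ℝ)) hpos
  rw [div_eq_iff (by positivity)] at h3
  linarith

/-! ### Periodic orbits near the corner -/

theorem continuous_tablePoint (s a t : Bool) : Continuous fun ξ : ℝ => tablePoint s (a, t, ξ) := by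
  refine (continuous_chart s).comp ?_
  cases a <;> cases t <;> simp only [boundaryPoint] <;> fun_prop

theorem tendsto_tablePoint (s a t : Bool) (c : ℝ) :
    Tendsto (fun k : ℕ => tablePoint s (a, t, c / 2 ^ k)) atTop (𝓝 (tablePoint s (a, t, 0))) := by
  refine ((continuous_tablePoint s a t).tendsto 0).comp ?_
  exact tendsto_const_nhds.div_atTop (tendsto_pow_atTop_atTop_of_one_lt one_lt_two)

theorem exists_periodic_near_corner {U : Set Plane} (hU : U ∈ 𝓝 ((12, -1) : Plane)) :
    ∃ p ∈ phaseSpace squareRhombus, p ∈ Function.periodicPts (billiardMap squareRhombus) ∧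
      ∃ k : ℕ, (trajectory squareRhombus p k).1 = true ∧ (trajectory squareRhombus p k).2 ∈ U := by
  have hc : tablePoint true (false, false, 0) = (12, -1) := by simp [tablePoint, boundaryPoint, chart]
  have hlim := tendsto_tablePoint true false false 3
  rw [hc] at hlim
  obtain ⟨k, hk⟩ := (hlim.eventually hU).exists
  have hmem : toPhase (true, (false, false, 3 / 2 ^ k), false, false, 3) ∈ phaseSpace squareRhombus :=
    toPhase_mem_phaseSpace_of_three_div ⟨k, rfl⟩ ⟨0, by simp⟩
  exact ⟨_, hmem, squareRhombus_mem_FP _ hmem, 0, rfl, hk⟩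

/-! ### Critical points and their limit points -/

/-- Every two steps double the second coordinate, which reaches the vertex value 4 after K
doublings. -/
theorem toPhase_mem_discontinuityLevel {s a b : Bool} (K : ℕ) (t : Bool) {ξ : ℝ} (hξ : 0 < ξ)
    (hξ4 : ξ < 4) :
    toPhase (s, (a, t, ξ), b, t, 4 / 2 ^ K) ∈ discontinuityLevel squareRhombus (2 * K) := by
  induction K generalizing t ξ with
  | zero =>
    exact ⟨⟨tablePoint_mem_curve ⟨hξ.le, hξ4.le⟩, tablePoint_mem_curve ⟨by simp, by simp⟩⟩,
      tablePoint_mem_vertices (by simp)⟩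
  | succ K ih =>
    have h1 : (1 : ℝ) ≤ 2 ^ K := one_le_pow₀ one_le_two
    have h2 : (4 : ℝ) / 2 ^ (K + 1) ≤ 2 := by
      rw [pow_succ, div_le_iff₀ (by positivity)]
      linarith
    have h0 : (0 : ℝ) < 4 / 2 ^ (K + 1) := by positivity
    have hr : Regular (s, (a, t, ξ), b, t, 4 / 2 ^ (K + 1)) := ⟨⟨hξ, hξ4⟩, h0, by dsimp; linarith⟩
    have hr' : Regular (step (s, (a, t, ξ), b, t, 4 / 2 ^ (K + 1))) := by
      refine ⟨hr.2, ?_, ?_⟩ <;> simp only [step, reflect, if_true] <;> linarith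
    have h3 : (2 : ℝ) * (4 / 2 ^ (K + 1)) = 4 / 2 ^ K := by
      rw [pow_succ]
      field_simp
    refine ⟨toPhase_mem_maxPhaseSpace hr, ?_⟩
    rw [billiardMap_toPhase hr]
    refine ⟨toPhase_mem_maxPhaseSpace hr', ?_⟩
    rw [billiardMap_toPhase hr', step_step h2, h3]
    exact ih (!t) (by linarith) (by linarith)

theorem infinite_criticalSet : (criticalSet squareRhombus).Infinite := by
  -- The exponent K + 1 keeps the coordinates below 4, where codes are unique.
  refine infinite_of_injective_forall_mem
    (f := fun K : ℕ => ((true, tablePoint true (false, false, 4 / 2 ^ (K + 1))) : TablePoint)) ?_ ?_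
  · have hb : ∀ K : ℕ, (0 : ℝ) < 4 / 2 ^ (K + 1) ∧ (4 : ℝ) / 2 ^ (K + 1) < 4 := by
      intro K
      have h1 : (1 : ℝ) ≤ 2 ^ K := one_le_pow₀ one_le_two
      refine ⟨by positivity, ?_⟩
      rw [pow_succ, div_lt_iff₀ (by positivity)]
      linarith
    intro K L h
    have h1 := tablePoint_inj (s := true) (X := (false, false, 4 / 2 ^ (K + 1)))
      (Y := (false, false, 4 / 2 ^ (L + 1))) (hb K) (hb L) (congrArg Prod.snd h)
    have h2 : (4 : ℝ) / 2 ^ (K + 1) = 4 / 2 ^ (L + 1) := congrArg (fun X => X.2.2) h1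
    have h3 : (2 : ℝ) ^ (K + 1) = 2 ^ (L + 1) := by
      field_simp at h2
      linarith
    have := pow_right_injective₀ (two_pos (α := ℝ)) (by norm_num) h3
    omega
  · intro K
    exact mem_iUnion.2 ⟨K + 1, _, toPhase_mem_discontinuityLevel (s := false) (a := false)
      (b := false) (K + 1) false (ξ := 3) (by norm_num) (by norm_num), rfl⟩

theorem eq_two_of_reflect {u : Bool} {X : Code} (hX : 0 < X.2.2 ∧ X.2.2 < 4)
    (h : (reflect u X).2.2 = 4) : X.2.2 = 2 := by
  obtain ⟨a, t, ξ⟩ := X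
  obtain ⟨h1, h2⟩ := hX
  dsimp only at h1 h2
  simp only [reflect] at h
  split_ifs at h <;> dsimp only at h ⊢ <;> linarith

/-- Halving and doubling shift the exponent. The branch 6 - ξ takes values strictly between 2 and 4,
so never 4/2^k. -/
theorem dyadic_of_reflect {u : Bool} {X : Code} (hX : 0 < X.2.2 ∧ X.2.2 < 4)
    (h : ∃ k : ℕ, (reflect u X).2.2 = 4 / 2 ^ k) : ∃ k : ℕ, X.2.2 = 4 / 2 ^ k := by
  obtain ⟨a, t, ξ⟩ := X
  obtain ⟨h1, h2⟩ := hX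
  dsimp only at h1 h2 ⊢
  obtain ⟨k, hk⟩ := h
  cases k with
  | zero =>
    have := eq_two_of_reflect (u := u) (X := (a, t, ξ)) ⟨h1, h2⟩ (by simpa using hk)
    exact ⟨1, by linarith⟩
  | succ k =>
    have h3 : (4 : ℝ) / 2 ^ (k + 1) = 4 / 2 ^ k / 2 := by rw [pow_succ]; field_simp
    have h4 : (4 : ℝ) / 2 ^ (k + 1 + 1) = 4 / 2 ^ (k + 1) / 2 := by rw [pow_succ]; field_simp
    have h5 : (4 : ℝ) / 2 ^ k ≤ 4 := div_le_self (by norm_num) (one_le_pow₀ one_le_two)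
    simp only [reflect] at hk
    split_ifs at hk <;> dsimp only at hk
    · exact ⟨k, by linarith⟩
    · exact ⟨k + 2, by linarith⟩
    · linarith

/-- Two steps of the map reflect the second component once, so even levels trace it back to a
vertex. -/
theorem proj₂_mem_of_mem_discontinuityLevel (i : ℕ) {p : PhasePoint}
    (hp : p ∈ discontinuityLevel squareRhombus (2 * i)) :
    proj₂ p ∈ vertexSet squareRhombus ∨
      ∃ (s a t : Bool) (k : ℕ), proj₂ p = (s, tablePoint s (a, t, 4 / 2 ^ k)) := by
  induction i generalizing p with
  | zero => exact Or.inl hp.2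
  | succ i ih =>
    obtain ⟨s, x, y⟩ := p
    obtain ⟨h1, h2, h3⟩ := hp
    obtain ⟨z, hz⟩ : ∃ z, billiardMap squareRhombus (s, x, y) = (!s, y, z) := ⟨_, dif_pos h1⟩
    rw [hz] at h2 h3
    obtain ⟨Y, hY, hy⟩ := exists_tablePoint h1.1.2 h1.2.1
    obtain ⟨Z, hZ, hw⟩ := exists_tablePoint h2.1.2 h2.2.1
    dsimp only at hy hw
    subst hy hw
    refine Or.inr ⟨!s, Y.1, Y.2.1, ?_⟩
    have hr : Regular (!s, Y, Z) := ⟨hY, hZ⟩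
    have h4 := ih (p := toPhase (step (!s, Y, Z))) (by
      rw [← billiardMap_toPhase hr]
      exact h3)
    suffices ∃ k : ℕ, (reflect Z.2.1 Y).2.2 = 4 / 2 ^ k by
      obtain ⟨k, hk⟩ := dyadic_of_reflect hY this
      exact ⟨k, by rw [← hk]; rfl⟩
    -- A corner has two codes, so 4 = 4/2^0 is handled before comparing codes.
    by_cases hv : (reflect Z.2.1 Y).2.2 = 4
    · exact ⟨0, by simpa using hv⟩
    have hW : 0 < (reflect Z.2.1 Y).2.2 ∧ (reflect Z.2.1 Y).2.2 < 4 :=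
      ⟨(reflect_mem hY).1, lt_of_le_of_ne (reflect_mem hY).2 hv⟩
    rcases h4 with h4 | ⟨s', a, t, k, h4⟩
    · exact absurd h4 (tablePoint_notMem_vertices hW)
    · simp only [proj₂, toPhase, step, Prod.mk.injEq] at h4
      obtain ⟨rfl, h4⟩ := h4
      cases k with
      | zero =>
        refine absurd (tablePoint_mem_vertices (Or.inr ?_)) (h4 ▸ tablePoint_notMem_vertices hW)
        simp
      | succ k =>
        have h5 : (1 : ℝ) ≤ 2 ^ k := one_le_pow₀ one_le_two
        have h6 : 0 < (4 : ℝ) / 2 ^ (k + 1) ∧ (4 : ℝ) / 2 ^ (k + 1) < 4 := by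
          refine ⟨by positivity, ?_⟩
          rw [pow_succ, div_lt_iff₀ (by positivity)]
          linarith
        exact ⟨k + 1, congrArg (fun X => X.2.2)
          (tablePoint_inj (Y := (a, t, 4 / 2 ^ (k + 1))) hW h6 h4)⟩

theorem eventually_notMem_of_finite {α : Type*} [TopologicalSpace α] [T1Space α] {S : Set α}
    (hS : S.Finite) (q : α) : ∀ᶠ x in 𝓝[≠] q, x ∉ S := by
  have h : (S \ {q})ᶜ ∈ 𝓝 q := (hS.subset sdiff_subset).isClosed.isOpen_compl.mem_nhds (by simp)
  filter_upwards [mem_nhdsWithin_of_mem_nhds h, self_mem_nhdsWithin] with x hx hq hxS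
  exact hx ⟨hxS, hq⟩

theorem eventually_notMem_range {α : Type*} [TopologicalSpace α] [T2Space α] {u : ℕ → α} {a q : α}
    (hu : Tendsto u atTop (𝓝 a)) (hq : q ≠ a) : ∀ᶠ x in 𝓝[≠] q, ∀ k, x ≠ u k := by
  obtain ⟨U, V, hU, hV, hqU, haV, hUV⟩ := t2_separation hq
  obtain ⟨n, hn⟩ := eventually_atTop.1 (hu.eventually (hV.mem_nhds haV))
  filter_upwards [mem_nhdsWithin_of_mem_nhds (hU.mem_nhds hqU),
    eventually_notMem_of_finite ((finite_Iio n).image u) q] with x hx hx' k hk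
  subst hk
  rcases lt_or_ge k n with h | h
  · exact hx' ⟨k, h, rfl⟩
  · exact disjoint_left.1 hUV hx (hn k h)

theorem finite_vertexSet : (vertexSet squareRhombus).Finite := by
  have hf : ∀ s, ((squareRhombus s).vertices).Finite := fun s =>
    (toFinite {chart s (0, 0), chart s (4, 0), chart s (4, 4), chart s (0, 4)}).subset
      fun z hz => by simpa using mem_vertices.1 hz
  exact (finite_univ.prod (finite_iUnion hf)).subset
    fun q hq => ⟨mem_univ _, mem_iUnion.2 ⟨q.1, hq⟩⟩

/-- Besides finitely many vertices, C lies on eight sequences, one for each sign, corner and type,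
each converging to a vertex. A non-vertex is none of these limits, so it has a punctured
neighbourhood free of C. -/
theorem mem_vertexSet_of_accPt {q : TablePoint} (hq : AccPt q (𝓟 (criticalSet squareRhombus))) :
    q ∈ vertexSet squareRhombus := by
  by_contra hv
  rw [accPt_iff_frequently_nhdsNE] at hq
  apply hq
  have h1 : ∀ s a t : Bool, ∀ᶠ x in 𝓝[≠] q, ∀ k : ℕ, x ≠ (s, tablePoint s (a, t, 4 / 2 ^ k)) := by
    intro s a t
    refine eventually_notMem_range (tendsto_const_nhds.prodMk_nhds (tendsto_tablePoint s a t 4)) ?_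
    rintro rfl
    exact hv (tablePoint_mem_vertices (Or.inl rfl))
  simp only [← eventually_all] at h1
  filter_upwards [h1, eventually_notMem_of_finite finite_vertexSet q] with x hx hx' hxC
  obtain ⟨i, p, hp, rfl⟩ := mem_iUnion.1 hxC
  rcases proj₂_mem_of_mem_discontinuityLevel i hp with h | ⟨s, a, t, k, h⟩
  exacts [hx' h, hx s a t k h]

end SymplecticBilliard

theorem mainTheorem7 :
    SymplecticBilliard.squareRhombus ∈ SymplecticBilliard.FP \ SymplecticBilliard.BP ∧
    (∀ U ∈ 𝓝 ((12, -1) : SymplecticBilliard.Plane),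
      ∃ p ∈ SymplecticBilliard.phaseSpace SymplecticBilliard.squareRhombus,
        p ∈ Function.periodicPts
          (SymplecticBilliard.billiardMap SymplecticBilliard.squareRhombus) ∧
        ∃ k : ℕ, (SymplecticBilliard.trajectory SymplecticBilliard.squareRhombus p k).1 = true ∧
          (SymplecticBilliard.trajectory SymplecticBilliard.squareRhombus p k).2 ∈ U) ∧
    (SymplecticBilliard.criticalSet SymplecticBilliard.squareRhombus).Infinite ∧
    (∀ q : SymplecticBilliard.TablePoint,
      AccPt q (𝓟 (SymplecticBilliard.criticalSet SymplecticBilliard.squareRhombus)) →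
        q ∈ SymplecticBilliard.vertexSet SymplecticBilliard.squareRhombus) :=
  ⟨⟨SymplecticBilliard.squareRhombus_mem_FP, SymplecticBilliard.squareRhombus_notMem_BP⟩,
    fun _ hU => SymplecticBilliard.exists_periodic_near_corner hU,
    SymplecticBilliard.infinite_criticalSet,
    fun _ hq => SymplecticBilliard.mem_vertexSet_of_accPt hq⟩
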